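/- A band is a semigroup in which every element is idempotent; it is normal if it satisfies the identity $xyzx=xzyx$. A rectangular band is a band satisfying $xyx=x$. A band $B$ is a semilattice $Y$ of rectangular bands $B_\alpha$ ($\alpha\in Y$) if $B$ is the disjoint union of non-empty rectangular bands $B_\alpha$ with $B_\alpha B_\beta\subseteq B_{\alpha\beta}$ for all $\alpha,\beta$ in the semilattice $Y$. It is a strong semilattice $B=\mathcal{B}(Y;B_\alpha,\phi_{\alpha,\beta})$ of rectangular bands if in addition there are morphisms $\phi_{\alpha,\beta}:B_\alpha\to B_\beta$ for $\alpha\ge\beta$ (written on the right) with $\phi_{\alpha,\alpha}=1_{B_\alpha}$, $\phi_{\alpha,\beta}\phi_{\beta,\gamma}=\phi_{\alpha,\gamma}$ for $\alpha\ge\beta\ge\gamma$, and $xy=(x\phi_{\alpha,\alpha\beta})(y\phi_{\beta,\alpha\beta})$ for all $x\in B_\alpha$, $y\in B_\beta$. Every normal band is such a strong semilattice. The band $B$ is called $Y$-basic if it is a semilattice $Y$ of rectangular bands $B_\alpha$ each of which is a left zero band ($xy=x$) or a right zero band ($xy=y$). A normal band $B=\mathcal{B}(Y;B_\alpha,\phi_{\alpha,\beta})$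 is called pliant if for every $\alpha\in Y$ there is $a_\alpha\in B_\alpha$ such that $u\phi_{\beta,\alpha}=a_\alpha$ for all $\beta>\alpha$ and all $u\in B_\beta$. The free idempotent generated semigroup over $B$ is the semigroup given by the presentation $$\mathrm{IG}(B)=\langle\,\overline{e}\ (e\in B)\ :\ \overline{e}\,\overline{f}=\overline{ef}\ \text{ whenever } \{e,f\}\cap\{ef,fe\}\neq\emptyset\,\rangle .$$ On a semigroup $S$ let $a\,\mathcal{L}^*\,b$ mean that $ax=ay\Leftrightarrow bx=by$ for all $x,y\in S^1$, and let $a\,\mathcal{R}^*\,b$ mean that $xa=ya\Leftrightarrow xb=yb$ for all $x,y\in S^1$. A semigroup is abundant if each $\mathcal{L}^*$-class and each $\mathcal{R}^*$-class contains an idempotent. **Theorem.** Let $B$ be a normal band that is $Y$-basic or pliant. Then $\mathrm{IG}(B)$ is abundant. -/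

import Mathlib

universe u

namespace IGBand

/-- A band: a semigroup all of whose elements are idempotent. -/
def IsBand (S : Type*) [Semigroup S] : Prop := ∀ x : S, IsIdempotentElem x

/-- A rectangular band: a band satisfying `xyx = x`. -/
def IsRectangularBand (S : Type*) [Semigroup S] : Prop :=
  IsBand S ∧ ∀ x y : S, x * y * x = x

/-- A left zero semigroup: `xy = x`. -/
def IsLeftZero (S : Type*) [Semigroup S] : Prop := ∀ x y : S, x * y = x

/-- A right zero semigroup: `xy = y`. -/
def IsRightZero (S : Type*) [Semigroup S] : Prop := ∀ x y : S, x * y = y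

/-- A normal band: a band satisfying `xyzx = xzyx`. -/
def IsNormalBand (S : Type*) [Semigroup S] : Prop :=
  IsBand S ∧ ∀ x y z : S, x * y * z * x = x * z * y * x

/-- A grading of the semigroup `B` by the (meet) semilattice `Y`: every element `x` lies in the
component `B_α` with index `α = index x`, no component is empty, and `B_α B_β ⊆ B_{αβ}`. -/
structure SemilatticeGrading (B : Type*) [Semigroup B] (Y : Type*) [SemilatticeInf Y] where
  index : B → Y
  index_surjective : Function.Surjective index
  index_mul : ∀ x y : B, index (x * y) = index x ⊓ index y

/-- The component `B_α`. -/
def SemilatticeGrading.component {B : Type*} [Semigroup B] {Y : Type*} [SemilatticeInf Y]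
    (G : SemilatticeGrading B Y) (α : Y) : Subsemigroup B where
  carrier := {x | G.index x = α}
  mul_mem' := by
    intro x y hx hy
    simp only [Set.mem_ofPred_eq] at hx hy ⊢
    rw [G.index_mul, hx, hy, inf_idem]

/-- `B` is a semilattice `Y` of rectangular bands `B_α`. -/
structure SemilatticeOfRectangularBands (B : Type*) [Semigroup B] (Y : Type*) [SemilatticeInf Y]
    extends SemilatticeGrading B Y where
  rectangular : ∀ α : Y, IsRectangularBand (toSemilatticeGrading.component α)

/-- `B = 𝓑(Y; B_α, φ_{α,β})` is a strong semilattice `Y` of rectangular bands `B_α`, with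
structure morphisms `φ_{α,β} : B_α → B_β` for `α ≥ β`. -/
structure StrongSemilatticeOfRectangularBands (B : Type*) [Semigroup B]
    (Y : Type*) [SemilatticeInf Y] extends SemilatticeOfRectangularBands B Y where
  φ : ∀ {α β : Y}, β ≤ α →
    (toSemilatticeGrading.component α →ₙ* toSemilatticeGrading.component β)
  φ_refl : ∀ (α : Y) (x : toSemilatticeGrading.component α), φ (le_refl α) x = x
  φ_trans : ∀ {α β γ : Y} (hβ : β ≤ α) (hγ : γ ≤ β) (x : toSemilatticeGrading.component α),
    φ hγ (φ hβ x) = φ (hγ.trans hβ) x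
  mul_eq : ∀ {α β : Y} (x : toSemilatticeGrading.component α)
    (y : toSemilatticeGrading.component β),
    (x : B) * (y : B) =
      ((φ (inf_le_left : α ⊓ β ≤ α) x * φ (inf_le_right : α ⊓ β ≤ β) y :
        toSemilatticeGrading.component (α ⊓ β)) : B)

/-- `B` is `Y`-basic for some semilattice `Y`: it is a semilattice `Y` of rectangular bands `B_α`,
each of which is a left zero band or a right zero band. (As `B` maps onto `Y`, nothing is lost by
taking `Y` in the universe of `B`.) -/
def IsYBasic (B : Type u) [Semigroup B] : Prop :=
  ∃ (Y : Type u) (_ : SemilatticeInf Y) (G : SemilatticeOfRectangularBands B Y),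
    ∀ α : Y, IsLeftZero (G.component α) ∨ IsRightZero (G.component α)

/-- `B` is pliant: it is a strong semilattice of rectangular bands such that every `B_α` contains
an element `a_α` with `u φ_{β,α} = a_α` for all `β > α` and all `u ∈ B_β`. -/
def IsPliant (B : Type u) [Semigroup B] : Prop :=
  ∃ (Y : Type u) (_ : SemilatticeInf Y) (G : StrongSemilatticeOfRectangularBands B Y),
    ∀ α : Y, ∃ a : G.component α, ∀ (β : Y) (h : α < β) (u : G.component β), G.φ h.le u = a

/-- The set `E(S)` of idempotents of `S`. -/
abbrev Idem (S : Type*) [Semigroup S] : Type _ := {e : S // IsIdempotentElem e}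

/-- `(e, f)` is a basic pair: `{e, f} ∩ {ef, fe} ≠ ∅`. -/
def IsBasicPair {S : Type*} [Semigroup S] (e f : S) : Prop :=
  (({e, f} : Set S) ∩ {e * f, f * e}).Nonempty

/-- The product of a basic pair of idempotents is idempotent. -/
theorem IsBasicPair.isIdempotentElem_mul {S : Type*} [Semigroup S] {e f : S}
    (h : IsBasicPair e f) (he : IsIdempotentElem e) (hf : IsIdempotentElem f) :
    IsIdempotentElem (e * f) := by
  obtain ⟨x, hx, hy⟩ := h
  simp only [Set.mem_insert_iff, Set.mem_singleton_iff] at hx hy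
  unfold IsIdempotentElem at *
  have key : e * f * (e * f) = e * (f * e) * f := by simp only [mul_assoc]
  rcases hx with rfl | rfl <;> rcases hy with hy | hy
  · rw [← hy, he]
  · rw [key, ← hy, he]
  · rw [← hy, hf]
  · rw [key, ← hy, mul_assoc, hf]

/-- The defining relations `ē f̄ = \overline{ef}`, for `(e, f)` a basic pair in `E(S)`. -/
inductive IGRel (S : Type*) [Semigroup S] :
    FreeSemigroup (Idem S) → FreeSemigroup (Idem S) → Prop
  | basic (e f : Idem S) (h : IsBasicPair (e : S) (f : S)) :
      IGRel S (FreeSemigroup.of e * FreeSemigroup.of f)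
        (FreeSemigroup.of ⟨(e : S) * (f : S), h.isIdempotentElem_mul e.2 f.2⟩)

/-- The free idempotent generated semigroup `IG(E)` over the biordered set `E = E(S)`: the
quotient of the free semigroup on `E(S)` by the congruence generated by the relations `IGRel`.
For a band `B` one has `E(B) = B`, and `IG B` is the semigroup `IG(B)`. -/
abbrev IG (S : Type*) [Semigroup S] : Type _ := (conGen (IGRel S)).Quotient

/-- The relation `𝓛*`. (`WithOne S` always adjoins a new identity; if `S` already has one, this
gives the same relation.) -/
def LStar {S : Type*} [Semigroup S] (a b : S) : Prop :=
  ∀ x y : WithOne S, (a : WithOne S) * x = (a : WithOne S) * y ↔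
    (b : WithOne S) * x = (b : WithOne S) * y

/-- The relation `𝓡*`. -/
def RStar {S : Type*} [Semigroup S] (a b : S) : Prop :=
  ∀ x y : WithOne S, x * (a : WithOne S) = y * (a : WithOne S) ↔
    x * (b : WithOne S) = y * (b : WithOne S)

/-- `S` is abundant: every `𝓛*`-class and every `𝓡*`-class contains an idempotent. -/
def IsAbundant (S : Type*) [Semigroup S] : Prop :=
  (∀ a : S, ∃ e : S, IsIdempotentElem e ∧ LStar a e) ∧
    ∀ a : S, ∃ e : S, IsIdempotentElem e ∧ RStar a e

end IGBand

/-!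
Reversing all products exchanges `𝓛*` and `𝓡*`, so only `𝓡*` matters. The key is a cancellation
law in `IG(B)¹`: if `b` does not lie strictly below `c` in the semilattice, then `X c̄ b̄ = Z c̄ b̄`
implies `X c̄ = Z c̄`; hence `X c̄ b̄` and `X c̄` are `𝓡*`-related. If `b` does lie
strictly below `c`, then `c̄ b̄ = ū b̄` with `u = cbc` in the component of `b`, and the law
applies to `u` instead. Deleting one letter at a time thus relates every element of `IG(B)` to a
single generator.

If `b` and `c` lie in the same component, the law holds as `c̄ = c̄ b̄ · \overline{bc}`.
Otherwise `b` is not below `c`, and a stack machine that reads words from left to right shows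
that enough of `X c̄` survives the multiplication by `b̄`. When a letter does not lie above the
current level, the machine suspends this level and remembers the value of the prefix multiplied
by an anchor, an element of the level which hides the effect of all letters above it. So either
`b` lies above the level of `X c̄` or the product of `X c̄` with an anchor can be read off from
the stack, and normality makes it possible to recover `X c̄`.
-/

namespace IGBand

open MulOpposite

section Presentation

variable {S T : Type*} [Semigroup S] [Semigroup T]

theorem isBasicPair_iff {e f : S} :
    IsBasicPair e f ↔ e * f = e ∨ f * e = e ∨ e * f = f ∨ f * e = f := by
  simp only [IsBasicPair, Set.Nonempty, Set.mem_inter_iff, Set.mem_insert_iff,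
    Set.mem_singleton_iff, or_and_right, exists_or, exists_eq_left, or_assoc,
    eq_comm (a := e), eq_comm (a := f)]

theorem IsBasicPair.op {e f : S} (h : IsBasicPair e f) : IsBasicPair (op f) (op e) := by
  simp only [isBasicPair_iff, ← op_mul, op_inj] at h ⊢
  tauto

theorem IsBasicPair.unop {e f : Sᵐᵒᵖ} (h : IsBasicPair e f) :
    IsBasicPair (unop f) (unop e) := by
  simp only [isBasicPair_iff, ← unop_mul, unop_inj] at h ⊢
  tauto

namespace IG

/-- The canonical generator `ē` of `IG S`. -/
def of (e : Idem S) : IG S := ((FreeSemigroup.of e : FreeSemigroup (Idem S)) : IG S)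

theorem of_mul_of {e f : Idem S} (h : IsBasicPair (e : S) (f : S)) :
    of e * of f = of ⟨(e : S) * f, h.isIdempotentElem_mul e.2 f.2⟩ :=
  (Con.eq _).2 (ConGen.Rel.of _ _ (IGRel.basic e f h))

theorem isIdempotentElem_of (e : Idem S) : IsIdempotentElem (of e) :=
  (of_mul_of (isBasicPair_iff.2 (.inl e.2))).trans (congrArg of (Subtype.ext e.2))

@[elab_as_elim]
theorem induction_on {P : IG S → Prop} (s : IG S) (of : ∀ e, P (of e))
    (mul : ∀ s t, P s → P t → P (s * t)) : P s := by
  induction s using Con.induction_on with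
  | H w =>
    induction w using FreeSemigroup.recOnMul with
    | ih1 e => exact of e
    | ih2 v w hv hw => exact mul _ _ hv hw

/-- The universal property of `IG S`: a map on idempotents that respects the products of basic
pairs extends to a homomorphism. -/
def lift (f : Idem S → T) (hf : ∀ (d e : Idem S) (h : IsBasicPair (d : S) (e : S)),
    f d * f e = f ⟨(d : S) * e, h.isIdempotentElem_mul d.2 e.2⟩) : IG S →ₙ* T where
  toFun s := Con.liftOn s (FreeSemigroup.lift f) fun _ _ h =>
    (Con.conGen_le (c := Con.ker (FreeSemigroup.lift f))).2
      (by rintro _ _ ⟨d, e, h⟩; simpa [Con.ker_rel] using hf d e h) h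
  map_mul' s t := by
    induction s using Con.induction_on
    induction t using Con.induction_on
    exact map_mul (FreeSemigroup.lift f) _ _

/-- The anti-homomorphism from `IG S` to `IG Sᵐᵒᵖ` that fixes the generators. -/
def toOp : IG S →ₙ* (IG Sᵐᵒᵖ)ᵐᵒᵖ :=
  lift (fun e => op (of ⟨op (e : S), congrArg op e.2⟩)) fun e f h =>
    unop_injective (of_mul_of (e := ⟨op (f : S), congrArg op f.2⟩)
      (f := ⟨op (e : S), congrArg op e.2⟩) h.op)

/-- The anti-homomorphism from `IG Sᵐᵒᵖ` to `IG S` that fixes the generators. -/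
def ofOp : IG Sᵐᵒᵖ →ₙ* (IG S)ᵐᵒᵖ :=
  lift (fun e => op (of ⟨unop (e : Sᵐᵒᵖ), congrArg unop e.2⟩)) fun e f h =>
    unop_injective (of_mul_of (e := ⟨unop (f : Sᵐᵒᵖ), congrArg unop f.2⟩)
      (f := ⟨unop (e : Sᵐᵒᵖ), congrArg unop e.2⟩) h.unop)

theorem ofOp_unop_toOp (s : IG S) : ofOp (unop (toOp s)) = op s := by
  induction s using induction_on with
  | of e => rfl
  | mul s t hs ht => rw [map_mul, unop_mul, map_mul, hs, ht, op_mul]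

theorem toOp_injective : Function.Injective (toOp : IG S → (IG Sᵐᵒᵖ)ᵐᵒᵖ) := fun s t h =>
  op_injective <| by rw [← ofOp_unop_toOp, h, ofOp_unop_toOp]

end IG

theorem RStar.lStar_of_injective {θ : S →ₙ* Tᵐᵒᵖ} (hθ : Function.Injective θ) {a b : S}
    (h : RStar (unop (θ a)) (unop (θ b))) : LStar a b := by
  let τ : WithOne S → WithOne T := WithOne.map fun s => unop (θ s)
  have τ_injective : Function.Injective τ := Option.map_injective (unop_injective.comp hθ)
  have τ_mul (a : S) (x : WithOne S) : τ (a * x) = τ x * (unop (θ a) : T) := by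
    induction x using WithOne.recOneCoe with
    | one => rw [mul_one]; exact (one_mul _).symm
    | coe x => exact congrArg (fun t : Tᵐᵒᵖ => ((unop t : T) : WithOne T)) (map_mul θ a x)
  intro x y
  simpa only [← τ_mul, τ_injective.eq_iff] using h (τ x) (τ y)

end Presentation

namespace IsBand

variable {B : Type*} [Semigroup B] (hB : IsBand B)

/-- The generator `b̄` of the free idempotent generated semigroup over a band, as an element of the
monoid `IG(B)¹`, in which all the computations below take place. -/
def gen (b : B) : WithOne (IG B) := (IG.of ⟨b, hB b⟩ : IG B)

theorem gen_mul_gen {e f : B} (h : IsBasicPair e f) : hB.gen e * hB.gen f = hB.gen (e * f) :=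
  congrArg WithOne.coe (IG.of_mul_of (e := ⟨e, hB e⟩) (f := ⟨f, hB f⟩) h)

theorem gen_mul_gen_eq_left {e f : B} (h : e * f = e) : hB.gen e * hB.gen f = hB.gen e := by
  rw [hB.gen_mul_gen (isBasicPair_iff.2 (.inl h)), h]

theorem gen_mul_gen_eq_right {e f : B} (h : e * f = f) : hB.gen e * hB.gen f = hB.gen f := by
  rw [hB.gen_mul_gen (isBasicPair_iff.2 (.inr (.inr (.inl h)))), h]

theorem gen_mul_self (b : B) : hB.gen b * hB.gen b = hB.gen b := hB.gen_mul_gen_eq_left (hB b)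

theorem gen_mul_gen_eq_mul_conj {d x : B} (h : d * x * d = d) :
    hB.gen d * hB.gen x = hB.gen d * hB.gen (x * d * x) := by
  have hxd : x * (x * d) = x * d := by rw [← mul_assoc, hB x]
  rw [← hB.gen_mul_gen (e := x * d) (isBasicPair_iff.2 (.inr (.inl hxd))), ← mul_assoc,
    hB.gen_mul_gen_eq_left (f := x * d) (by rw [← mul_assoc, h])]

theorem gen_mul_gen_eq_conj_mul {d x : B} (h : d * x * d = d) :
    hB.gen x * hB.gen d = hB.gen (x * d * x) * hB.gen d := by
  have hdx : d * x * x = d * x := by rw [mul_assoc, hB x]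
  rw [mul_assoc x, ← hB.gen_mul_gen (isBasicPair_iff.2 (.inr (.inr (.inr hdx)))), mul_assoc,
    hB.gen_mul_gen_eq_right h]

/-- `ū` is recovered from `ū k̄` by multiplying by `\overline{ku}`. -/
theorem eq_of_mul_gen_eq {u k : B} (huk : u * k * u = u) {X Y : WithOne (IG B)}
    (hX : X * hB.gen u = X) (hY : Y * hB.gen u = Y) (h : X * hB.gen k = Y * hB.gen k) :
    X = Y := by
  have hu : hB.gen u * hB.gen k * hB.gen (k * u) = hB.gen u := by
    rw [mul_assoc, hB.gen_mul_gen_eq_right (by rw [← mul_assoc, hB k]),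
      hB.gen_mul_gen_eq_left (by rw [← mul_assoc, huk])]
  have recover {Z : WithOne (IG B)} (hZ : Z * hB.gen u = Z) :
      Z * hB.gen k * hB.gen (k * u) = Z := by
    rw [← hZ, mul_assoc, mul_assoc, ← mul_assoc (hB.gen u), hu]
  rw [← recover hX, h, recover hY]

theorem mul_gen_mul_gen_conj {d x : B} (h : d * x * d = d) {X : WithOne (IG B)}
    (hX : X * hB.gen d = X) :
    X * hB.gen x * hB.gen (x * d * x) = X * hB.gen x := by
  rw [← hX, mul_assoc X, hB.gen_mul_gen_eq_mul_conj h, mul_assoc, mul_assoc, hB.gen_mul_self]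

@[elab_as_elim]
theorem gen_induction {P : WithOne (IG B) → Prop} (X : WithOne (IG B)) (one : P 1)
    (mul_gen : ∀ X b, P X → P (X * hB.gen b)) : P X := by
  have mul_coe (s : IG B) : ∀ X, P X → P (X * s) := by
    induction s using IG.induction_on with
    | of e => exact fun X => mul_gen X e
    | mul s t hs ht => exact fun X hX => mul_assoc X s t ▸ ht _ (hs X hX)
  induction X using WithOne.recOneCoe with
  | one => exact one
  | coe s => exact one_mul (s : WithOne (IG B)) ▸ mul_coe s 1 one

theorem exists_orbit_map {σ : Type*} (act : B → σ → σ)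
    (hact : ∀ e f, IsBasicPair e f → ∀ s, act f (act e s) = act (e * f) s) (s₀ : σ) :
    ∃ D : WithOne (IG B) → σ, D 1 = s₀ ∧ ∀ X b, D (X * hB.gen b) = act b (D X) := by
  let F : IG B →ₙ* (Function.End σ)ᵐᵒᵖ :=
    IG.lift (fun e => op (act e)) fun e f h => unop_injective (funext (hact e f h))
  refine ⟨fun X => unop (WithOne.lift F X) s₀, rfl, fun X b => ?_⟩
  exact congrArg (fun f : (Function.End σ)ᵐᵒᵖ => (unop f : σ → σ) s₀)
    (map_mul (WithOne.lift F) X (hB.gen b))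

end IsBand

namespace SemilatticeOfRectangularBands

variable {B Y : Type*} [Semigroup B] [SemilatticeInf Y]

theorem isBand (G : SemilatticeOfRectangularBands B Y) : IsBand B := fun x =>
  congrArg Subtype.val ((G.rectangular (G.index x)).1 ⟨x, rfl⟩)

variable (G : SemilatticeOfRectangularBands B Y)

theorem mul_mul_cancel_of_index_eq {x y : B} (h : G.index x = G.index y) : x * y * x = x :=
  congrArg Subtype.val ((G.rectangular (G.index x)).2 ⟨x, rfl⟩ ⟨y, h.symm⟩)

theorem index_conj {d x : B} (h : G.index d ≤ G.index x) : G.index (x * d * x) = G.index d := by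
  rw [G.index_mul, G.index_mul, inf_eq_right.2 h, inf_eq_left.2 h]

theorem mul_mul_cancel_of_index_le {d x : B} (h : G.index d ≤ G.index x) : d * x * d = d := by
  have hdx : G.index d = G.index (d * x) := by rw [G.index_mul, inf_eq_left.2 h]
  simpa only [← mul_assoc, (G.isBand d).eq] using G.mul_mul_cancel_of_index_eq hdx

/-- In a strong semilattice, `xdx` is the image of `x` in the component of `d` under a structure
morphism. -/
theorem conj_eq_conj (hB : IsNormalBand B) (x : B) {d e : B} (h : G.index d = G.index e) :
    x * d * x = x * e * x := by
  have hd : x * d * x = x * (e * d) * x := calc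
    x * d * x = x * (d * e * d) * x := by rw [G.mul_mul_cancel_of_index_eq h]
    _ = x * d * (e * d) * x := by simp only [mul_assoc]
    _ = x * (e * d) * d * x := hB.2 _ _ _
    _ = x * (e * d) * x := by rw [mul_assoc x, mul_assoc e, hB.1 d]
  have he : x * e * x = x * (e * d) * x := calc
    x * e * x = x * (e * d * e) * x := by rw [G.mul_mul_cancel_of_index_eq h.symm]
    _ = x * (e * d) * e * x := by simp only [mul_assoc]
    _ = x * e * (e * d) * x := hB.2 _ _ _
    _ = x * (e * d) * x := by rw [mul_assoc x, ← mul_assoc e, hB.1 e]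
  rw [hd, he]

theorem index_le_or_le_of_isBasicPair {e f : B} (h : IsBasicPair e f) :
    G.index e ≤ G.index f ∨ G.index f ≤ G.index e := by
  rcases isBasicPair_iff.1 h with h | h | h | h
  · exact .inl (inf_eq_left.1 (by rw [← G.index_mul, h]))
  · exact .inl (inf_eq_right.1 (by rw [← G.index_mul, h]))
  · exact .inr (inf_eq_right.1 (by rw [← G.index_mul, h]))
  · exact .inr (inf_eq_left.1 (by rw [← G.index_mul, h]))

/-- The same decomposition of the opposite band, which exchanges the roles of `𝓛*` and `𝓡*`. -/
def op : SemilatticeOfRectangularBands Bᵐᵒᵖ Y where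
  index b := G.index (unop b)
  index_surjective α := (G.index_surjective α).imp' MulOpposite.op fun _ => id
  index_mul x y := (G.index_mul _ _).trans (inf_comm _ _)
  rectangular α := by
    refine ⟨fun x => Subtype.ext (congrArg MulOpposite.op (G.isBand _)), fun x y => ?_⟩
    refine Subtype.ext (unop_injective ?_)
    change unop (x : Bᵐᵒᵖ) * (unop (y : Bᵐᵒᵖ) * unop (x : Bᵐᵒᵖ)) = unop (x : Bᵐᵒᵖ)
    rw [← mul_assoc]
    exact G.mul_mul_cancel_of_index_eq (x.2.trans y.2.symm)

end SemilatticeOfRectangularBands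

theorem IsNormalBand.op {B : Type*} [Semigroup B] (hB : IsNormalBand B) : IsNormalBand Bᵐᵒᵖ :=
  ⟨fun x => congrArg MulOpposite.op (hB.1 (unop x)), fun x y z => unop_injective <| by
    simpa only [unop_mul, mul_assoc] using hB.2 (unop x) (unop z) (unop y)⟩

section Anchors

variable {B Y : Type*} [Semigroup B] [SemilatticeInf Y]

/-- An anchor of a component `B_α`: an `a ∈ B_α` such that for all `d ∈ B_α` and all `x` in a higher
component, `d` absorbs `x` on its right or `a` absorbs `x` on its left. Left zero components, right
zero components and the elements `a_α` of a pliant band all provide anchors. -/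
def SemilatticeGrading.IsAnchor (G : SemilatticeGrading B Y) (a : B) : Prop :=
  ∀ d x : B, G.index d = G.index a → G.index a < G.index x → d * x = d ∨ x * a = a

/-- Every component contains an anchor. -/
def SemilatticeGrading.HasAnchors (G : SemilatticeGrading B Y) : Prop :=
  ∀ α : Y, ∃ a : B, G.index a = α ∧ G.IsAnchor a

namespace SemilatticeOfRectangularBands

variable (G : SemilatticeOfRectangularBands B Y)

theorem isAnchor_of_isLeftZero {a : B} (h : IsLeftZero (G.component (G.index a))) :
    G.IsAnchor a := by
  intro d x hd hx
  have hdx : G.index (d * x) = G.index a := by rw [G.index_mul, hd, inf_eq_left.2 hx.le]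
  have hdd : d * (d * x) = d := congrArg Subtype.val (h ⟨d, hd⟩ ⟨d * x, hdx⟩)
  rw [← mul_assoc, (G.isBand d).eq] at hdd
  exact .inl hdd

theorem isAnchor_of_isRightZero {a : B} (h : IsRightZero (G.component (G.index a))) :
    G.IsAnchor a := by
  intro _ x _ hx
  have hxa : G.index (x * a) = G.index a := by rw [G.index_mul, inf_eq_right.2 hx.le]
  have haa : x * a * a = a := congrArg Subtype.val (h ⟨x * a, hxa⟩ ⟨a, rfl⟩)
  rw [mul_assoc, (G.isBand a).eq] at haa
  exact .inr haa

theorem hasAnchors_of_forall_isLeftZero_or_isRightZero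
    (h : ∀ α, IsLeftZero (G.component α) ∨ IsRightZero (G.component α)) : G.HasAnchors := by
  intro α
  obtain ⟨a, rfl⟩ := G.index_surjective α
  exact ⟨a, rfl, (h _).elim G.isAnchor_of_isLeftZero G.isAnchor_of_isRightZero⟩

theorem isRightZero_component_op {α : Y} (h : IsLeftZero (G.component α)) :
    IsRightZero (G.op.component α) := fun x y =>
  Subtype.ext (unop_injective (congrArg Subtype.val (h ⟨unop y, y.2⟩ ⟨unop x, x.2⟩)))

theorem isLeftZero_component_op {α : Y} (h : IsRightZero (G.component α)) :
    IsLeftZero (G.op.component α) := fun x y =>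
  Subtype.ext (unop_injective (congrArg Subtype.val (h ⟨unop y, y.2⟩ ⟨unop x, x.2⟩)))

end SemilatticeOfRectangularBands

namespace StrongSemilatticeOfRectangularBands

variable (G : StrongSemilatticeOfRectangularBands B Y) {α β : Y}

theorem coe_mul_coe_eq_φ_mul (h : β ≤ α) (x : G.component α) (y : G.component β) :
    (x : B) * y = G.φ h x * y := by
  have of_eq_inf : ∀ γ (hα : γ ≤ α) (hβ : γ ≤ β), γ = α ⊓ β →
      (x : B) * y = (G.φ hα x * G.φ hβ y : G.component γ) := by
    rintro _ _ _ rfl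
    exact G.mul_eq x y
  rw [of_eq_inf β h le_rfl (inf_eq_right.2 h).symm, G.φ_refl, MulMemClass.coe_mul]

theorem coe_mul_coe_eq_mul_φ (h : β ≤ α) (x : G.component α) (y : G.component β) :
    (y : B) * x = y * G.φ h x := by
  have of_eq_inf : ∀ γ (hβ : γ ≤ β) (hα : γ ≤ α), γ = β ⊓ α →
      (y : B) * x = (G.φ hβ y * G.φ hα x : G.component γ) := by
    rintro _ _ _ rfl
    exact G.mul_eq y x
  rw [of_eq_inf β le_rfl h (inf_eq_left.2 h).symm, G.φ_refl, MulMemClass.coe_mul]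

end StrongSemilatticeOfRectangularBands

end Anchors

theorem IsYBasic.exists_hasAnchors {B : Type u} [Semigroup B] (h : IsYBasic B) :
    ∃ (Y : Type u) (_ : SemilatticeInf Y) (G : SemilatticeOfRectangularBands B Y),
      G.HasAnchors ∧ G.op.HasAnchors := by
  obtain ⟨Y, _, G, hG⟩ := h
  exact ⟨Y, _, G, G.hasAnchors_of_forall_isLeftZero_or_isRightZero hG,
    G.op.hasAnchors_of_forall_isLeftZero_or_isRightZero fun α =>
      (hG α).symm.imp G.isLeftZero_component_op G.isRightZero_component_op⟩

theorem IsPliant.exists_hasAnchors {B : Type u} [Semigroup B] (h : IsPliant B) :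
    ∃ (Y : Type u) (_ : SemilatticeInf Y) (G : SemilatticeOfRectangularBands B Y),
      G.HasAnchors ∧ G.op.HasAnchors := by
  obtain ⟨Y, _, G, hG⟩ := h
  refine ⟨Y, _, G.toSemilatticeOfRectangularBands, fun α => ?_, fun α => ?_⟩ <;>
    obtain ⟨a, ha⟩ := hG α
  · refine ⟨a, a.2, fun _ x _ hx => .inr ?_⟩
    have hx : α < G.index x := a.2 ▸ hx
    rw [G.coe_mul_coe_eq_φ_mul hx.le ⟨x, rfl⟩ a, ha _ hx, (G.isBand a).eq]
  · refine ⟨op a, a.2, fun _ x _ hx => .inr (unop_injective ?_)⟩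
    have hx : α < G.index (unop x) := a.2 ▸ hx
    exact (G.coe_mul_coe_eq_mul_φ hx.le ⟨unop x, rfl⟩ a).trans (by rw [ha _ hx]; exact G.isBand a)

open Classical in
/-- Discards the initial entries of a list that are tagged with a level above `β`. -/
noncomputable def dropAbove {Γ M : Type*} [LT Γ] (β : Γ) (l : List (Γ × M)) : List (Γ × M) :=
  l.dropWhile fun x => β < x.1

section DropAbove

variable {Γ M : Type*}

theorem dropAbove_cons_of_lt [LT Γ] {β γ : Γ} (h : β < γ) (m : M) (l : List (Γ × M)) :
    dropAbove β ((γ, m) :: l) = dropAbove β l := by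
  simp only [dropAbove, List.dropWhile_cons, h, decide_true, if_true]

theorem dropAbove_cons_of_not_lt [LT Γ] {β γ : Γ} (h : ¬ β < γ) (m : M) (l : List (Γ × M)) :
    dropAbove β ((γ, m) :: l) = (γ, m) :: l := by
  simp only [dropAbove, List.dropWhile_cons, h, decide_false, Bool.false_eq_true, if_false]

theorem dropAbove_dropAbove [Preorder Γ] {β γ : Γ} (h : β ≤ γ) (l : List (Γ × M)) :
    dropAbove β (dropAbove γ l) = dropAbove β l := by
  induction l with
  | nil => rfl
  | cons x l ih =>
    by_cases hx : γ < x.1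
    · rw [dropAbove_cons_of_lt hx, dropAbove_cons_of_lt (h.trans_lt hx), ih]
    · rw [dropAbove_cons_of_not_lt hx]

end DropAbove

section Stack

variable {B Y : Type*} [Semigroup B] [SemilatticeInf Y] (G : SemilatticeOfRectangularBands B Y)

local notation "ι" => IsBand.gen (SemilatticeOfRectangularBands.isBand G)

/-- The state of a stack machine that reads a word over `B` from left to right. `val` is the value
of the word, `top` the current level, which is the index of the last letter not above the level
before it (`⊤` for the empty word), and `below` stores, for each suspended level, that level and the
value of the prefix read there times an anchor. -/
@[ext]
structure StackState where
  val : WithOne (IG B)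
  top : WithTop Y
  below : List (WithTop Y × WithOne (IG B))
  exists_absorbed : top ≠ ⊤ → ∃ d : B, (G.index d : WithTop Y) = top ∧ val * ι d = val

namespace StackState

variable {G}

/-- The state before any letter is read. -/
def empty : StackState G := ⟨1, ⊤, [], fun h => (h rfl).elim⟩

open Classical in
/-- Reading the letter `b`. If `b` lies above the current level, it leaves the stack unchanged;
otherwise the level becomes that of `b`, and all levels above it are discarded. The function `a`
supplies the anchors. -/
noncomputable def act (a : WithTop Y → WithOne (IG B)) (b : B) (s : StackState G) :
    StackState G where
  val := s.val * ι b
  top := if s.top ≤ G.index b then s.top else G.index b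
  below := if s.top ≤ G.index b then s.below else
    dropAbove ↑(G.index b) ((s.top, s.val * a s.top) :: s.below)
  exists_absorbed h := by
    split_ifs at h ⊢ with hb
    · obtain ⟨d, hd, hs⟩ := s.exists_absorbed h
      have hdb : G.index d ≤ G.index b := WithTop.coe_le_coe.1 (hd ▸ hb)
      refine ⟨b * d * b, by rw [G.index_conj hdb, hd], ?_⟩
      exact G.isBand.mul_gen_mul_gen_conj (G.mul_mul_cancel_of_index_le hdb) hs
    · exact ⟨b, rfl, by rw [mul_assoc, G.isBand.gen_mul_self]⟩

variable {a : WithTop Y → WithOne (IG B)} {b c : B} {s s' : StackState G}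

theorem top_act_of_le (h : s.top ≤ G.index b) : (act a b s).top = s.top := if_pos h

theorem top_act_of_not_le (h : ¬ s.top ≤ G.index b) : (act a b s).top = G.index b := if_neg h

theorem below_act_of_le (h : s.top ≤ G.index b) : (act a b s).below = s.below := if_pos h

theorem below_act_of_not_le (h : ¬ s.top ≤ G.index b) : (act a b s).below =
    dropAbove ↑(G.index b) ((s.top, s.val * a s.top) :: s.below) := if_neg h

theorem top_act_le : (act a b s).top ≤ G.index b := by
  by_cases h : s.top ≤ G.index b
  · rwa [top_act_of_le h]
  · rw [top_act_of_not_le h]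

theorem act_act_of_index_le {e f : B} (h : IsBasicPair e f) (hef : G.index e ≤ G.index f) :
    act a f (act a e s) = act a (e * f) s := by
  have hf : (act a e s).top ≤ G.index f := top_act_le.trans (WithTop.coe_le_coe.2 hef)
  have index_mul : G.index (e * f) = G.index e := (G.index_mul _ _).trans (inf_eq_left.2 hef)
  refine StackState.ext ((mul_assoc _ _ _).trans (congrArg _ (G.isBand.gen_mul_gen h))) ?_ ?_
  · rw [top_act_of_le hf]
    simp only [act]
    rw [index_mul]
  · rw [below_act_of_le hf]
    simp only [act]
    rw [index_mul]

theorem act_act_of_index_lt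
    (ha : ∀ (d x : B) (X : WithOne (IG B)), G.index d < G.index x → X * ι d = X →
      X * ι x * a (G.index d) = X * a (G.index d))
    {e f : B} (h : IsBasicPair e f) (hfe : G.index f < G.index e) :
    act a f (act a e s) = act a (e * f) s := by
  have index_mul : G.index (e * f) = G.index f := (G.index_mul _ _).trans (inf_eq_right.2 hfe.le)
  have hfe' : (G.index f : WithTop Y) < G.index e := WithTop.coe_lt_coe.2 hfe
  refine StackState.ext ((mul_assoc _ _ _).trans (congrArg _ (G.isBand.gen_mul_gen h))) ?_ ?_
  · simp only [act]
    rw [index_mul]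
    split_ifs <;> grind
  · by_cases he : s.top ≤ G.index e
    · by_cases hf : s.top ≤ G.index f
      · have hef : s.top ≤ G.index (e * f) := by rwa [index_mul]
        rw [below_act_of_le ((top_act_of_le he).trans_le hf), below_act_of_le he,
          below_act_of_le hef]
      · have hef : ¬ s.top ≤ G.index (e * f) := by rwa [index_mul]
        rw [below_act_of_not_le (by rwa [top_act_of_le he]), below_act_of_not_le hef,
          below_act_of_le he, top_act_of_le he, index_mul]
        obtain he | he := he.eq_or_lt
        · rw [he, dropAbove_cons_of_lt hfe', dropAbove_cons_of_lt hfe']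
        · obtain ⟨d, hd, hsd⟩ := s.exists_absorbed he.ne_top
          have hde : G.index d < G.index e := WithTop.coe_lt_coe.1 (hd ▸ he)
          rw [← hd, ← ha d e s.val hde hsd]
          rfl
    · have hef : ¬ s.top ≤ G.index (e * f) := by
        rw [index_mul]
        exact fun hf => he (hf.trans hfe'.le)
      rw [below_act_of_not_le (by rw [top_act_of_not_le he]; exact hfe'.not_ge),
        below_act_of_not_le hef, below_act_of_not_le he, top_act_of_not_le he, index_mul,
        dropAbove_cons_of_lt hfe', dropAbove_dropAbove hfe'.le]

theorem act_act
    (ha : ∀ (d x : B) (X : WithOne (IG B)), G.index d < G.index x → X * ι d = X →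
      X * ι x * a (G.index d) = X * a (G.index d))
    {e f : B} (h : IsBasicPair e f) : act a f (act a e s) = act a (e * f) s := by
  by_cases hef : G.index e ≤ G.index f
  · exact act_act_of_index_le h hef
  · exact act_act_of_index_lt ha h
      (((G.index_le_or_le_of_isBasicPair h).resolve_left hef).lt_of_not_ge hef)

/-- As `s.top` is not above `b`, an entry pushed when reading `b` is not discarded immediately. -/
theorem eq_of_act_eq (hbc : ¬ G.index b ≤ G.index c) (hs : s.top ≤ G.index c)
    (hs' : s'.top ≤ G.index c) (h : act a b s = act a b s') :
    s.top = s'.top ∧ (s.top ≤ G.index b ∨ s.val * a s.top = s'.val * a s.top) := by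
  have htop : (act a b s).top = (act a b s').top := congrArg top h
  have hbelow : (act a b s).below = (act a b s').below := congrArg below h
  have not_lt {t : WithTop Y} (ht : t ≤ G.index c) : ¬ (G.index b : WithTop Y) < t := fun hbt =>
    hbc (WithTop.coe_le_coe.1 (hbt.le.trans ht))
  by_cases hb : s.top ≤ G.index b <;> by_cases hb' : s'.top ≤ G.index b
  · rw [top_act_of_le hb, top_act_of_le hb'] at htop
    exact ⟨htop, .inl hb⟩
  · rw [top_act_of_le hb, top_act_of_not_le hb'] at htop
    exact (hbc (WithTop.coe_le_coe.1 (htop ▸ hs))).elim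
  · rw [top_act_of_not_le hb, top_act_of_le hb'] at htop
    exact (hbc (WithTop.coe_le_coe.1 (htop ▸ hs'))).elim
  · rw [below_act_of_not_le hb, below_act_of_not_le hb', dropAbove_cons_of_not_lt (not_lt hs),
      dropAbove_cons_of_not_lt (not_lt hs'), List.cons.injEq, Prod.mk.injEq] at hbelow
    exact ⟨hbelow.1.1, .inr (hbelow.1.1 ▸ hbelow.1.2)⟩

/-- By normality, the absorbed letter can be chosen to depend only on `c` and the level. -/
theorem val_mul_gen_conj_eq (hB : IsNormalBand B) {u : B} (hc : s.val * ι c = s.val)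
    (hs : s.top ≤ G.index c) (hu : G.index u = s.top) : s.val * ι (c * u * c) = s.val := by
  obtain ⟨d, hd, hsd⟩ := s.exists_absorbed (hs.trans_lt (WithTop.coe_lt_top _)).ne
  have hdc : G.index d ≤ G.index c := WithTop.coe_le_coe.1 (hd ▸ hs)
  have hud : G.index u = G.index d := WithTop.coe_injective (hu.trans hd.symm)
  simpa only [hc, G.conj_eq_conj hB c hud] using
    G.isBand.mul_gen_mul_gen_conj (G.mul_mul_cancel_of_index_le hdc) hsd

end StackState

namespace SemilatticeOfRectangularBands

theorem mul_gen_mul_gen_of_isAnchor {a d x : B} (ha : G.IsAnchor a) (hd : G.index d = G.index a)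
    (hx : G.index d < G.index x) {X : WithOne (IG B)} (hX : X * ι d = X) :
    X * ι x * ι a = X * ι a := by
  rcases ha d x hd (hd ▸ hx) with h | h
  · rw [← hX, mul_assoc X, G.isBand.gen_mul_gen_eq_left h]
  · rw [mul_assoc, G.isBand.gen_mul_gen_eq_right h]

theorem exists_stackState {a : Y → B} (ha : ∀ α, G.index (a α) = α ∧ G.IsAnchor (a α)) :
    ∃ D : WithOne (IG B) → StackState G, (∀ X, (D X).val = X) ∧
      ∀ X b, D (X * ι b) = (D X).act (WithTop.recTopCoe 1 fun α => ι (a α)) b := by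
  obtain ⟨D, hD_one, hD⟩ := G.isBand.exists_orbit_map
    (StackState.act (G := G) (WithTop.recTopCoe 1 fun α => ι (a α)))
    (fun e f hef s => StackState.act_act (fun d x X hx hX =>
      G.mul_gen_mul_gen_of_isAnchor (ha _).2 (ha _).1.symm hx hX) hef) StackState.empty
  refine ⟨D, fun X => ?_, hD⟩
  induction X using G.isBand.gen_induction with
  | one => rw [hD_one]; rfl
  | mul_gen X b ih => rw [hD]; exact congrArg (· * ι b) ih

theorem mul_gen_cancel (hB : IsNormalBand B) (hG : G.HasAnchors) {b c : B}
    (hbc : ¬ G.index b < G.index c) {X X' : WithOne (IG B)}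
    (h : X * ι c * ι b = X' * ι c * ι b) : X * ι c = X' * ι c := by
  have absorb (Z : WithOne (IG B)) : Z * ι c * ι c = Z * ι c := by
    rw [mul_assoc, G.isBand.gen_mul_self]
  by_cases hle : G.index b ≤ G.index c
  · have hcb : G.index c = G.index b := (hle.eq_of_not_lt hbc).symm
    exact G.isBand.eq_of_mul_gen_eq (G.mul_mul_cancel_of_index_eq hcb) (absorb X) (absorb X') h
  choose a ha using hG
  obtain ⟨D, hD_val, hD⟩ := G.exists_stackState ha
  have top_le (Z) : (D (Z * ι c)).top ≤ G.index c := hD Z c ▸ StackState.top_act_le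
  obtain ⟨top_eq, h_top⟩ := StackState.eq_of_act_eq hle (top_le X) (top_le X')
    (by rw [← hD, ← hD, h])
  obtain ⟨p, hp⟩ := WithTop.ne_top_iff_exists.1 ((top_le X).trans_lt (WithTop.coe_lt_top _)).ne
  have hpc : p ≤ G.index c := WithTop.coe_le_coe.1 (hp ▸ top_le X)
  have index_u : G.index (c * a p * c) = p := by
    rw [G.index_conj (by rwa [(ha p).1]), (ha p).1]
  have absorb_u (Z) (hZ : (D (Z * ι c)).top = p) : Z * ι c * ι (c * a p * c) = Z * ι c := by
    have h_conj := (D (Z * ι c)).val_mul_gen_conj_eq hB (u := a p) (c := c)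
      (by rw [hD_val, absorb]) (top_le Z) (by rw [hZ, (ha p).1])
    rwa [hD_val] at h_conj
  rw [hD_val, hD_val, ← hp] at h_top
  have hX := absorb_u X hp.symm
  have hX' := absorb_u X' (top_eq ▸ hp.symm)
  rcases h_top with hpb | h_anchor
  · exact G.isBand.eq_of_mul_gen_eq (G.mul_mul_cancel_of_index_le
      (index_u.trans_le (WithTop.coe_le_coe.1 hpb))) hX hX' h
  · exact G.isBand.eq_of_mul_gen_eq (G.mul_mul_cancel_of_index_eq (index_u.trans (ha p).1.symm))
      hX hX' h_anchor

theorem exists_mul_eq_mul_iff_mul_gen (hB : IsNormalBand B) (hG : G.HasAnchors)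
    (X : WithOne (IG B)) (b : B) :
    ∃ e, ∀ Z W : WithOne (IG B), Z * (X * ι b) = W * (X * ι b) ↔ Z * ι e = W * ι e := by
  induction X using G.isBand.gen_induction generalizing b with
  | one => exact ⟨b, fun Z W => by rw [one_mul]⟩
  | mul_gen X c ih =>
    have drop_last {c : B} (hbc : ¬ G.index b < G.index c) : ∃ e, ∀ Z W : WithOne (IG B),
        Z * (X * ι c * ι b) = W * (X * ι c * ι b) ↔ Z * ι e = W * ι e := by
      obtain ⟨e, he⟩ := ih c
      refine ⟨e, fun Z W => Iff.trans ⟨fun h => ?_, fun h => ?_⟩ (he Z W)⟩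
      · simp only [← mul_assoc] at h ⊢
        exact G.mul_gen_cancel hB hG hbc h
      · rw [← mul_assoc Z, h, mul_assoc W]
    by_cases hbc : G.index b < G.index c
    · rw [mul_assoc, G.isBand.gen_mul_gen_eq_conj_mul (G.mul_mul_cancel_of_index_le hbc.le),
        ← mul_assoc]
      exact drop_last (G.index_conj hbc.le).not_gt
    · exact drop_last hbc

theorem exists_rStar_of (hB : IsNormalBand B) (hG : G.HasAnchors) (s : IG B) :
    ∃ b, RStar s (IG.of ⟨b, G.isBand b⟩) := by
  have last_letter (X : WithOne (IG B)) : X = 1 ∨ ∃ Z b, X = Z * ι b := by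
    induction X using G.isBand.gen_induction with
    | one => exact .inl rfl
    | mul_gen Z b => exact .inr ⟨Z, b, rfl⟩
  obtain ⟨X, b, hs⟩ := (last_letter s).resolve_left WithOne.coe_ne_one
  obtain ⟨e, he⟩ := G.exists_mul_eq_mul_iff_mul_gen hB hG X b
  rw [← hs] at he
  exact ⟨e, he⟩

end SemilatticeOfRectangularBands

end Stack

end IGBand

theorem mainTheorem3_general {B Y : Type*} [Semigroup B] [SemilatticeInf Y]
    (hB : IGBand.IsNormalBand B) (G : IGBand.SemilatticeOfRectangularBands B Y)
    (hG : G.HasAnchors) (hG_op : G.op.HasAnchors) : IGBand.IsAbundant (IGBand.IG B) := by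
  refine ⟨fun s => ?_, fun s => ?_⟩
  · obtain ⟨b, hb⟩ := G.op.exists_rStar_of hB.op hG_op (IGBand.IG.toOp s).unop
    exact ⟨_, IGBand.IG.isIdempotentElem_of ⟨b.unop, G.isBand b.unop⟩,
      hb.lStar_of_injective IGBand.IG.toOp_injective⟩
  · obtain ⟨b, hb⟩ := G.exists_rStar_of hB hG s
    exact ⟨_, IGBand.IG.isIdempotentElem_of _, hb⟩

theorem mainTheorem3 (B : Type u) [Semigroup B] (hB : IGBand.IsNormalBand B)
    (h : IGBand.IsYBasic B ∨ IGBand.IsPliant B) : IGBand.IsAbundant (IGBand.IG B) := by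
  obtain ⟨Y, _, G, hG, hG_op⟩ := h.elim (·.exists_hasAnchors) (·.exists_hasAnchors)
  exact mainTheorem3_general hB G hG hG_op
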